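/- Let $X$ be a compact Hermitian manifold with fundamental (Kähler) form $\omega$. For a holomorphic map $f:\mathbb{C}\to X$ define $|df|(z)\ge 0$ by $f^*\omega=|df|^2\,dx\,dy$ $(z=x+iy)$. Let $\mathcal{M}(X)$ be the space of Brody curves, i.e. of holomorphic maps $f:\mathbb{C}\to X$ with $|df|(z)\le 1$ for all $z\in\mathbb{C}$, equipped with the compact-open topology and with the $\mathbb{C}$-action $(a,f(z))\mapsto f(z+a)$. For $f\in\mathcal{M}(X)$ put \[ \rho(f):=\lim_{R\to\infty}\Bigl(\frac{1}{\pi R^2}\sup_{a\in\mathbb{C}}\int_{|z-a|<R}|df|^2\,dx\,dy\Bigr), \] and for $\mathcal{N}\subset\mathcal{M}(X)$ put $\rho(\mathcal{N}):=\sup_{f\in\mathcal{N}}\rho(f)$ (a supremum in $[0,\infty]$, so that it is $0$ for $\mathcal{N}=\emptyset$). Theorem. Let $\mathcal{N}\subset\mathcal{M}(X)$ be a closed $\mathbb{C}$-invariant subset. Then the limit defining $\rho(f)$ exists for every $f\in\mathcal{N}$, $\rho(\mathcal{N})$ is finite, the limit on the right-hand side below exists, and \[ \rho(\mathcal{N})=\lim_{R\to\infty}\Bigl(\frac{1}{\pi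 R^2}\sup_{f\in\mathcal{N}}\int_{|z|<R}|df|^2\,dx\,dy\Bigr). \] -/

import Mathlib

open scoped Manifold ContDiff Topology ENNReal

noncomputable section

namespace BrodyDensity

section Manifold

variable {E : Type*} [NormedAddCommGroup E] [NormedSpace ℂ E]
  {X : Type*} [TopologicalSpace X] [ChartedSpace E X]

/-- The underlying real manifold of a complex manifold. -/
instance isManifold_real {n : WithTop ℕ∞} [IsManifold 𝓘(ℂ, E) n X] : IsManifold 𝓘(ℝ, E) n X :=
  isManifold_of_contDiffOn _ _ _ fun e e' he he' => by
    have h := (contDiffGroupoid n 𝓘(ℂ, E)).compatible he he'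
    rw [contDiffGroupoid, mem_groupoid_of_pregroupoid] at h
    exact ContDiffOn.restrict_scalars ℝ h.1

/-- A holomorphic map is real differentiable. -/
theorem mdifferentiableAt_real {f : ℂ → X} {z : ℂ}
    (hf : MDifferentiableAt 𝓘(ℂ, ℂ) 𝓘(ℂ, E) f z) :
    MDifferentiableAt 𝓘(ℝ, ℂ) 𝓘(ℝ, E) f z := by
  rw [mdifferentiableAt_iff] at hf ⊢
  exact ⟨hf.1, hf.2.restrictScalars ℝ⟩

/-- The complex structure `J` of the tangent space of a complex manifold: multiplication by
the imaginary unit (the tangent space at `x` is the model space `E`, identified through the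
holomorphic chart at `x`). -/
def J {x : X} (v : TangentSpace 𝓘(ℝ, E) x) : TangentSpace 𝓘(ℝ, E) x :=
  let w : E := v
  (Complex.I • w : E)

variable (E X) in
/-- A smooth Hermitian metric on a complex manifold: a smooth Riemannian metric on the underlying
real manifold that is invariant under the complex structure. -/
structure HermitianMetric [IsManifold 𝓘(ℂ, E) ω X] extends
    Bundle.ContMDiffRiemannianMetric 𝓘(ℝ, E) ∞ E (TangentSpace 𝓘(ℝ, E) : X → Type _) where
  inner_J (x : X) (v w : TangentSpace 𝓘(ℝ, E) x) : inner x (J v) (J w) = inner x v w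

variable [IsManifold 𝓘(ℂ, E) ω X]

/-- The fundamental ("Kähler") form `ω(v, w) = g(Jv, w)` of a Hermitian metric. -/
def kahlerForm (g : HermitianMetric E X) (x : X) (v w : TangentSpace 𝓘(ℝ, E) x) : ℝ :=
  g.inner x (J v) w

/-- The coefficient of `f^* ω` with respect to `dx ∧ dy`, namely
`(f^* ω)(∂/∂x, ∂/∂y) = ω(df(∂/∂x), df(∂/∂y))`. -/
def pullbackKahler (g : HermitianMetric E X) (f : ℂ → X) (z : ℂ) : ℝ :=
  kahlerForm g (f z) (mfderiv 𝓘(ℝ, ℂ) 𝓘(ℝ, E) f z (1 : ℂ))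
    (mfderiv 𝓘(ℝ, ℂ) 𝓘(ℝ, E) f z (Complex.I : ℂ))

/-- The spherical derivative `|df|(z) ≥ 0`, characterised by `f^* ω = |df|² dx dy`. -/
def sphericalDeriv (g : HermitianMetric E X) (f : ℂ → X) (z : ℂ) : ℝ :=
  √(pullbackKahler g f z)

/-- The space of Brody curves: holomorphic maps `f : ℂ → X` with `|df| ≤ 1`, with the
compact-open topology (the subspace topology from `C(ℂ, X)`). -/
abbrev BrodyCurve (g : HermitianMetric E X) : Type _ :=
  {f : C(ℂ, X) // MDifferentiable 𝓘(ℂ, ℂ) 𝓘(ℂ, E) f ∧ ∀ z, sphericalDeriv g f z ≤ 1}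

/-- `∫_{|z - a| < R} |df|² dx dy`. -/
def energy (g : HermitianMetric E X) (f : BrodyCurve g) (a : ℂ) (R : ℝ) : ℝ≥0∞ :=
  ∫⁻ z in Metric.ball a R, ENNReal.ofReal (sphericalDeriv g f.1 z ^ 2)

/-- The normalized quantity `(1 / (π R²)) sup_{a ∈ ℂ} ∫_{|z - a| < R} |df|² dx dy`. -/
def meanEnergy (g : HermitianMetric E X) (f : BrodyCurve g) (R : ℝ) : ℝ≥0∞ :=
  (⨆ a : ℂ, energy g f a R) / ENNReal.ofReal (Real.pi * R ^ 2)

/-- The energy density `ρ(f) = lim_{R → ∞} (1 / (π R²)) sup_a ∫_{|z - a| < R} |df|² dx dy`. -/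
def rho (g : HermitianMetric E X) (f : BrodyCurve g) : ℝ≥0∞ :=
  Filter.limUnder Filter.atTop (meanEnergy g f)

/-- `ρ(N) = sup_{f ∈ N} ρ(f)`. -/
def rhoSet (g : HermitianMetric E X) (N : Set (BrodyCurve g)) : ℝ≥0∞ :=
  ⨆ f ∈ N, rho g f

theorem pullbackKahler_translate (g : HermitianMetric E X) {f : ℂ → X}
    (hf : MDifferentiable 𝓘(ℂ, ℂ) 𝓘(ℂ, E) f) (a z : ℂ) :
    pullbackKahler g (fun w => f (w + a)) z = pullbackKahler g f (z + a) := by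
  have h1 : HasMFDerivAt 𝓘(ℝ, ℂ) 𝓘(ℝ, ℂ) (fun w : ℂ => w + a) z
      (ContinuousLinearMap.id ℝ ℂ) :=
    ((hasFDerivAt_id (𝕜 := ℝ) z).add_const a).hasMFDerivAt
  have h2 := (mdifferentiableAt_real (hf (z + a))).hasMFDerivAt
  have h3 := (HasMFDerivAt.comp z h2 h1).mfderiv
  have h4 : mfderiv 𝓘(ℝ, ℂ) 𝓘(ℝ, E) (fun w => f (w + a)) z
      = mfderiv 𝓘(ℝ, ℂ) 𝓘(ℝ, E) f (z + a) := h3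
  unfold pullbackKahler
  rw [h4]
  rfl

/-- The action of `ℂ` on the space of Brody curves, `(a, f(z)) ↦ f(z + a)`. -/
def translate (g : HermitianMetric E X) (a : ℂ) (f : BrodyCurve g) : BrodyCurve g :=
  ⟨⟨fun z => f.1 (z + a), by fun_prop⟩, by
    refine ⟨fun z => ?_, fun z => ?_⟩
    · have h1 : MDifferentiableAt 𝓘(ℂ, ℂ) 𝓘(ℂ, ℂ) (fun w : ℂ => w + a) z :=
        (differentiableAt_id.add_const a).mdifferentiableAt
      exact MDifferentiableAt.comp (g := f.1) z (f.2.1 (z + a)) h1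
    · have h := f.2.2 (z + a)
      unfold sphericalDeriv at h ⊢
      exact (congrArg Real.sqrt (pullbackKahler_translate g f.2.1 a z)).trans_le h⟩

end Manifold

end BrodyDensity

end

/-!
The proof has a part about disk averages in the plane and a part about the space of Brody curves.

For a measurable `φ ≥ 0` on `ℂ`, averaging the disks of radius `r` over their centres shows that
a uniform bound on the means over disks of radius `r` bounds the means over all larger disks, up
to the factor `((R + r) / R) ^ 2` (`lintegral_ball_le_of_forall_le`). Hence the normalised
suprema converge, and to their infimum over the radius (`tendsto_div_area`). This gives both
limits, and the inequality `ρ(N) ≤ L`, where `L` is the limit for the whole family `N`.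

For `L ≤ ρ(N)`, suppose `ρ(N) < c < L`. Choose radii `r k → ∞` so large that every mean of every
`f ∈ N` at radius `r k` is at most `L + δ k`, with `∑ δ k < L - c`. Every `f ∈ N` has density
below `c`, so its mean over the disk of radius `r k` centred at `0` is below `c` for some `k`;
since `N` is compact and the energy depends continuously on `f`, finitely many `k` suffice for all
of `N`. Take a large disk on which some `f ∈ N` has mean almost `L`. As `N` is invariant under
translations, every centre in this disk is low (has mean below `c`) at one of these finitely many
radii. But the means at radius `r k` average to almost `L` and never exceed `L + δ k`, so the low
centres at radius `r k` fill a proportion of at most about `δ k / (L - c)`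
(`volume_low_average_le`). These proportions sum to less than one, a contradiction
(`iSup_limit_density_eq`).

The remaining inputs are the compactness of the space of Brody curves and the continuity of the
energy. For a holomorphic curve, `|df|² = g(df(1), df(1))` (`pullbackKahler_eq`), so a Brody curve
is `1`-Lipschitz for the Riemannian distance (`riemannianEDist_le`), and Arzelà–Ascoli applies. In
charts, a locally uniform limit of holomorphic maps is holomorphic with convergent derivatives;
so the limits of Brody curves are Brody curves and `|df|` depends continuously on the curve
(`continuousOn_pullbackKahler`). Dominated convergence, with the bound `|df| ≤ 1`, gives the
continuity of the energy.
-/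

noncomputable section

namespace BrodyDensity

open MeasureTheory Metric Filter Bundle

/-! ### Averages over disks in the plane -/

section Plane

theorem volume_ball_eq (a : ℂ) {r : ℝ} (hr : 0 ≤ r) :
    volume (ball a r) = ENNReal.ofReal (Real.pi * r ^ 2) := by
  rw [Complex.volume_ball, mul_comm, ENNReal.ofReal_mul Real.pi_pos.le, ENNReal.ofReal_pow hr,
    ← NNReal.coe_real_pi, ENNReal.ofReal_coe_nnreal]

/-- Disk integrals as integrals of a jointly measurable kernel in the centre `b` and the point `z`,
the form in which Tonelli's theorem applies. -/
theorem lintegral_ball_eq_indicator (φ : ℂ → ℝ≥0∞) (b : ℂ) (r : ℝ) :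
    ∫⁻ z in ball b r, φ z =
      ∫⁻ z, {p : ℂ × ℂ | dist p.2 p.1 < r}.indicator (fun p => φ p.2) (b, z) := by
  rw [← lintegral_indicator measurableSet_ball]
  rfl

theorem measurableSet_dist_lt (r : ℝ) : MeasurableSet {p : ℂ × ℂ | dist p.2 p.1 < r} :=
  (isOpen_lt (by fun_prop) continuous_const).measurableSet

theorem measurable_lintegral_ball {φ : ℂ → ℝ≥0∞} (hφ : Measurable φ) (r : ℝ) :
    Measurable fun b => ∫⁻ z in ball b r, φ z := by
  simp_rw [lintegral_ball_eq_indicator]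
  exact ((hφ.comp measurable_snd).indicator (measurableSet_dist_lt r)).lintegral_prod_right'

/-- Averaging over centres (Tonelli): every point of the disk of radius `R` belongs to the disks of
radius `r` around a set of centres of area `π r²`, all within distance `R + r` of `a`. -/
theorem lintegral_ball_mul_le {φ : ℂ → ℝ≥0∞} (hφ : Measurable φ) (a : ℂ) {r R : ℝ}
    (hr : 0 ≤ r) :
    (∫⁻ z in ball a R, φ z) * ENNReal.ofReal (Real.pi * r ^ 2) ≤
      ∫⁻ b in ball a (R + r), ∫⁻ z in ball b r, φ z := by
  have hm : Measurable ({p : ℂ × ℂ | dist p.2 p.1 < r}.indicator fun p => φ p.2) :=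
    (hφ.comp measurable_snd).indicator (measurableSet_dist_lt r)
  simp_rw [lintegral_ball_eq_indicator φ _ r]
  rw [lintegral_lintegral_swap
      (f := fun b z => {p : ℂ × ℂ | dist p.2 p.1 < r}.indicator (fun p => φ p.2) (b, z))
      hm.aemeasurable,
    ← lintegral_mul_const _ hφ]
  refine le_trans ?_ (setLIntegral_le_lintegral (ball a R) _)
  refine setLIntegral_mono' measurableSet_ball fun z hz => ?_
  -- for `z` in the smaller disk, the disk of radius `r` around `z` stays in the larger one
  have hsub : ball z r ⊆ ball a (R + r) := fun b hb => by
    have := dist_triangle b z a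
    rw [mem_ball] at hb hz ⊢
    linarith
  calc φ z * ENNReal.ofReal (Real.pi * r ^ 2) = ∫⁻ _ in ball z r, φ z := by
        rw [setLIntegral_const, volume_ball_eq z hr]
    _ = ∫⁻ b in ball z r, {p : ℂ × ℂ | dist p.2 p.1 < r}.indicator (fun p => φ p.2) (b, z) := by
        refine setLIntegral_congr_fun measurableSet_ball fun b hb => ?_
        have : (b, z) ∈ {p : ℂ × ℂ | dist p.2 p.1 < r} := by
          simpa [dist_comm] using hb
        simp only [Set.indicator_of_mem this]
    _ ≤ _ := lintegral_mono_set hsub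

/-- Comparison of scales: a bound `S` for all disks of radius `r` controls every
disk of radius `R`. -/
theorem lintegral_ball_le_of_forall_le {φ : ℂ → ℝ≥0∞} (hφ : Measurable φ) {r R : ℝ}
    (hr : 0 ≤ r) (hR : 0 ≤ R) {S : ℝ≥0∞} (hS : ∀ b, ∫⁻ z in ball b r, φ z ≤ S) (a : ℂ) :
    (∫⁻ z in ball a R, φ z) * ENNReal.ofReal (Real.pi * r ^ 2) ≤
      S * ENNReal.ofReal (Real.pi * (R + r) ^ 2) := by
  refine (lintegral_ball_mul_le hφ a hr).trans ?_
  calc _ ≤ ∫⁻ _ in ball a (R + r), S := lintegral_mono fun b => hS b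
    _ = _ := by rw [setLIntegral_const, volume_ball_eq a (by positivity)]

/-- A weak-type bound. If all means at radius `r` are at most `M` and the mean over the disk of
radius `R` about `0` is at least `l`, then the centres in that disk whose mean at radius `r` is
below `c` have small total area. -/
theorem volume_low_average_le {φ : ℂ → ℝ≥0∞} (hφ : Measurable φ) {r R : ℝ}
    (hr : 0 < r) (hR : 0 ≤ R) {c l M : ℝ} (hc : 0 ≤ c) (hcM : c ≤ M) (hl : 0 ≤ l)
    (hM : ∀ b, ∫⁻ z in ball b r, φ z ≤ ENNReal.ofReal M * ENNReal.ofReal (Real.pi * r ^ 2))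
    (h : ENNReal.ofReal l * ENNReal.ofReal (Real.pi * R ^ 2) ≤ ∫⁻ z in ball 0 R, φ z) :
    (M - c) * volume.real
      {b ∈ ball (0 : ℂ) R |
        ∫⁻ z in ball b r, φ z < ENNReal.ofReal c * ENNReal.ofReal (Real.pi * r ^ 2)} ≤
      M * (Real.pi * (R + r) ^ 2) - l * (Real.pi * R ^ 2) := by
  set A := {b ∈ ball (0 : ℂ) R |
    ∫⁻ z in ball b r, φ z < ENNReal.ofReal c * ENNReal.ofReal (Real.pi * r ^ 2)} with hA
  set B := ball (0 : ℂ) (R + r) with hB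
  have hAm : MeasurableSet A :=
    measurableSet_ball.inter (measurableSet_lt (measurable_lintegral_ball hφ r) measurable_const)
  have hAB : A ⊆ B := fun b hb => ball_subset_ball (by linarith) hb.1
  have hBfin : volume B ≠ ⊤ := measure_ball_lt_top.ne
  have hAfin : volume A ≠ ⊤ := ((measure_mono hAB).trans_lt measure_ball_lt_top).ne
  have hp : 0 < Real.pi * r ^ 2 := by positivity
  have h1 := lintegral_ball_mul_le hφ 0 (R := R) hr.le
  have h2 : ∫⁻ b in B, ∫⁻ z in ball b r, φ z ≤
      (ENNReal.ofReal c * volume A + ENNReal.ofReal M * volume (B \ A)) *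
        ENNReal.ofReal (Real.pi * r ^ 2) := by
    rw [← lintegral_inter_add_sdiff _ B hAm, Set.inter_eq_self_of_subset_right hAB, add_mul]
    refine add_le_add ?_ ?_
    · refine (setLIntegral_mono' hAm fun b hb => hb.2.le).trans_eq ?_
      rw [setLIntegral_const]; ring
    · refine (lintegral_mono fun b => hM b).trans_eq ?_
      rw [setLIntegral_const]; ring
  have h3 : ENNReal.ofReal l * ENNReal.ofReal (Real.pi * R ^ 2) ≤
      ENNReal.ofReal c * volume A + ENNReal.ofReal M * volume (B \ A) := by
    refine h.trans ?_
    rw [← ENNReal.mul_le_mul_iff_left (c := ENNReal.ofReal (Real.pi * r ^ 2))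
      (by simpa using hp) ENNReal.ofReal_ne_top]
    exact h1.trans h2
  have hBA : volume (B \ A) = ENNReal.ofReal (volume.real B - volume.real A) := by
    rw [← measureReal_sdiff hAB hAm, measureReal_def, ENNReal.ofReal_toReal]
    exact ((measure_mono Set.sdiff_subset).trans_lt measure_ball_lt_top).ne
  have hAB' : volume.real A ≤ volume.real B := measureReal_mono hAB hBfin
  have hA0 : 0 ≤ volume.real A := measureReal_nonneg
  rw [hBA, ← ENNReal.ofReal_toReal hAfin, ← measureReal_def, ← ENNReal.ofReal_mul hl,
    ← ENNReal.ofReal_mul hc, ← ENNReal.ofReal_mul (hc.trans hcM),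
    ← ENNReal.ofReal_add (by positivity)
      (mul_nonneg (hc.trans hcM) (by linarith)), ENNReal.ofReal_le_ofReal_iff
      (add_nonneg (by positivity) (mul_nonneg (hc.trans hcM) (by linarith)))] at h3
  have hBv : volume.real B = Real.pi * (R + r) ^ 2 := by
    rw [measureReal_def, volume_ball_eq 0 (by positivity), ENNReal.toReal_ofReal (by positivity)]
  rw [hBv] at h3
  linarith

/-- A two-dimensional analogue of Fekete's lemma: the comparison of scales forces `S R / (π R²)` to
converge to its infimum. -/
theorem tendsto_div_area {S : ℝ → ℝ≥0∞}
    (h : ∀ r R : ℝ, 0 < r → 0 < R →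
      S R * ENNReal.ofReal (Real.pi * r ^ 2) ≤ S r * ENNReal.ofReal (Real.pi * (R + r) ^ 2)) :
    Tendsto (fun R => S R / ENNReal.ofReal (Real.pi * R ^ 2)) atTop
      (𝓝 (⨅ r : Set.Ioi (0 : ℝ), S r / ENNReal.ofReal (Real.pi * (r : ℝ) ^ 2))) := by
  refine tendsto_of_le_liminf_of_limsup_le ?_ ?_
  · refine le_liminf_of_le (by isBoundedDefault) ?_
    filter_upwards [eventually_gt_atTop 0] with R hR
    exact iInf_le (fun r : Set.Ioi (0 : ℝ) => S r / ENNReal.ofReal (Real.pi * (r : ℝ) ^ 2)) ⟨R, hR⟩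
  · refine le_iInf fun ⟨r, hr⟩ => ?_
    rw [Set.mem_Ioi] at hr
    set s := S r / ENNReal.ofReal (Real.pi * r ^ 2) with hs
    have hpr : ENNReal.ofReal (Real.pi * r ^ 2) ≠ 0 := by
      simpa using (by positivity : 0 < Real.pi * r ^ 2)
    have hle : ∀ᶠ R : ℝ in atTop, S R / ENNReal.ofReal (Real.pi * R ^ 2) ≤
        s * ENNReal.ofReal ((1 + r / R) ^ 2) := by
      filter_upwards [eventually_gt_atTop 0] with R hR
      have hpR : 0 < Real.pi * R ^ 2 := by positivity
      rw [ENNReal.div_le_iff (by simpa using hpR) ENNReal.ofReal_ne_top, mul_assoc,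
        ← ENNReal.ofReal_mul (by positivity),
        show (1 + r / R) ^ 2 * (Real.pi * R ^ 2) = Real.pi * (R + r) ^ 2 by field_simp,
        hs, ENNReal.mul_comm_div, ← mul_div_assoc,
        ENNReal.le_div_iff_mul_le (Or.inl hpr) (Or.inl ENNReal.ofReal_ne_top)]
      exact h r R hr hR
    have hlim : Tendsto (fun R : ℝ => s * ENNReal.ofReal ((1 + r / R) ^ 2)) atTop (𝓝 s) := by
      have h0 : Tendsto (fun R : ℝ => (1 + r / R) ^ 2) atTop (𝓝 1) := by
        simpa using ((tendsto_const_nhds (x := r)).div_atTop tendsto_id).const_add 1 |>.pow 2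
      have := ENNReal.Tendsto.const_mul (a := s) (ENNReal.tendsto_ofReal h0) (Or.inl (by simp))
      simpa using this
    exact (limsup_le_limsup hle).trans hlim.limsup_eq.le

end Plane

/-! ### Densities of a compact family invariant under translations -/

section Dynamics

/-- The theorem for an abstract compact family `N` of densities `F f ≤ 1` on the plane, invariant
under the translations `T a`, with energies of disks depending continuously on `f`. -/
theorem iSup_limit_density_eq {M : Type*} [TopologicalSpace M] {N : Set M} (hN : IsCompact N)
    {F : M → ℂ → ℝ≥0∞} {T : ℂ → M → M} (hmeas : ∀ f, Measurable (F f)) (hF1 : ∀ f z, F f z ≤ 1)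
    (hT : ∀ a, ∀ f ∈ N, T a f ∈ N) (hFT : ∀ a f z, F (T a f) z = F f (z + a))
    (hcont : ∀ r, Continuous fun f => ∫⁻ z in ball 0 r, F f z) :
    (∀ f, Tendsto (fun R : ℝ => (⨆ a, ∫⁻ z in ball a R, F f z) / ENNReal.ofReal (Real.pi * R ^ 2))
      atTop (𝓝 (limUnder atTop fun R : ℝ =>
        (⨆ a, ∫⁻ z in ball a R, F f z) / ENNReal.ofReal (Real.pi * R ^ 2)))) ∧
    (⨆ f ∈ N, limUnder atTop fun R : ℝ =>
        (⨆ a, ∫⁻ z in ball a R, F f z) / ENNReal.ofReal (Real.pi * R ^ 2)) ≤ 1 ∧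
    Tendsto (fun R : ℝ => (⨆ f ∈ N, ∫⁻ z in ball 0 R, F f z) / ENNReal.ofReal (Real.pi * R ^ 2))
      atTop (𝓝 (⨆ f ∈ N, limUnder atTop fun R : ℝ =>
        (⨆ a, ∫⁻ z in ball a R, F f z) / ENNReal.ofReal (Real.pi * R ^ 2))) := by
  set ρ : M → ℝ≥0∞ := fun f => limUnder atTop fun R : ℝ =>
    (⨆ a, ∫⁻ z in ball a R, F f z) / ENNReal.ofReal (Real.pi * R ^ 2) with hρ
  have hshift : ∀ a f r, ∫⁻ z in ball a r, F f z = ∫⁻ z in ball 0 r, F (T a f) z := by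
    intro a f r
    have hpre : (fun z : ℂ => z + a) ⁻¹' ball a r = ball 0 r := by
      ext z; simp [dist_eq_norm]
    simp_rw [hFT]
    rw [← hpre]
    exact ((measurePreserving_add_right volume a).setLIntegral_comp_preimage
      measurableSet_ball (hmeas f)).symm
  have hlim : ∀ f, Tendsto
      (fun R : ℝ => (⨆ a, ∫⁻ z in ball a R, F f z) / ENNReal.ofReal (Real.pi * R ^ 2))
      atTop (𝓝 (ρ f)) := fun f => by
    refine tendsto_nhds_limUnder ⟨_, tendsto_div_area fun r R hr hR => ?_⟩
    rw [ENNReal.iSup_mul]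
    exact iSup_le fun a => lintegral_ball_le_of_forall_le (hmeas f) hr.le hR.le
      (le_iSup (fun b => ∫⁻ z in ball b r, F f z)) a
  have hSle : ∀ r, ∀ f ∈ N, ∀ a, ∫⁻ z in ball a r, F f z ≤ ⨆ f ∈ N, ∫⁻ z in ball 0 r, F f z := by
    intro r f hf a
    rw [hshift]
    exact le_iSup₂ (f := fun f (_ : f ∈ N) => ∫⁻ z in ball 0 r, F f z) _ (hT a f hf)
  set L : ℝ≥0∞ := ⨅ r : Set.Ioi (0 : ℝ),
    (⨆ f ∈ N, ∫⁻ z in ball 0 (r : ℝ), F f z) / ENNReal.ofReal (Real.pi * (r : ℝ) ^ 2) with hLdef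
  have hlimN : Tendsto
      (fun R : ℝ => (⨆ f ∈ N, ∫⁻ z in ball 0 R, F f z) / ENNReal.ofReal (Real.pi * R ^ 2))
      atTop (𝓝 L) := by
    -- By invariance of `N`, the bound for disks about `0` holds for disks about every point.
    refine tendsto_div_area (S := fun R => ⨆ f ∈ N, ∫⁻ z in ball 0 R, F f z) fun r R hr hR => ?_
    refine ENNReal.mul_le_of_le_div (iSup₂_le fun f hf => ?_)
    have hp : ENNReal.ofReal (Real.pi * r ^ 2) ≠ 0 := by
      simpa using (by positivity : 0 < Real.pi * r ^ 2)
    rw [ENNReal.le_div_iff_mul_le (Or.inl hp) (Or.inl ENNReal.ofReal_ne_top)]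
    exact lintegral_ball_le_of_forall_le (hmeas f) hr.le hR.le (hSle r f hf) 0
  have hL1 : L ≤ 1 := by
    refine iInf_le_of_le ⟨1, Set.mem_Ioi.2 one_pos⟩ ?_
    refine ENNReal.div_le_of_le_mul ?_
    refine iSup₂_le fun f _ => (lintegral_mono (hF1 f)).trans_eq ?_
    rw [setLIntegral_const, volume_ball_eq 0 zero_le_one]
  have hle : ⨆ f ∈ N, ρ f ≤ L := by
    refine iSup₂_le fun f hf => le_of_tendsto_of_tendsto' (hlim f) hlimN fun R => ?_
    exact ENNReal.div_le_div_right (iSup_le (hSle R f hf)) _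
  have hge : L ≤ ⨆ f ∈ N, ρ f := by
    by_contra! hlt
    obtain ⟨c, hc, hcL⟩ := exists_between hlt
    have hLtop : L ≠ ⊤ := (hL1.trans_lt ENNReal.one_lt_top).ne
    have hctop : c ≠ ⊤ := hcL.ne_top
    lift L to NNReal using hLtop with l hl
    lift c to NNReal using hctop
    have hcl : (c : ℝ) < l := by exact_mod_cast hcL
    obtain ⟨δ, hδ, hδsum⟩ := (Set.countable_univ (α := ℕ)).exists_pos_forall_sum_le
      (half_pos (sub_pos.2 hcl))
    -- radii at which all averages are almost at most `L`
    have hrad : ∀ k : ℕ, ∃ r : ℝ, (k : ℝ) + 1 ≤ r ∧ ∀ f ∈ N, ∀ b, ∫⁻ z in ball b r, F f z ≤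
        ENNReal.ofReal (l + δ k) * ENNReal.ofReal (Real.pi * r ^ 2) := by
      intro k
      have h1 : (l : ℝ≥0∞) < ENNReal.ofReal (l + δ k) := by
        rw [← ENNReal.ofReal_coe_nnreal]
        exact (ENNReal.ofReal_lt_ofReal_iff (by have := hδ k; positivity)).2
          (by have := hδ k; linarith)
      obtain ⟨r, hr1, hr2⟩ := ((hlimN.eventually_lt_const h1).and
        (eventually_ge_atTop ((k : ℝ) + 1))).exists
      refine ⟨r, hr2, fun f hf b => (hSle r f hf b).trans ?_⟩
      have hr0 : 0 < r := lt_of_lt_of_le (by positivity) hr2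
      have hp : 0 < Real.pi * r ^ 2 := by positivity
      exact ((ENNReal.div_le_iff (by simpa using hp) ENNReal.ofReal_ne_top).1 hr1.le)
    choose r hrk hrM using hrad
    have hr0 : ∀ k, 0 < r k := fun k => lt_of_lt_of_le (by positivity) (hrk k)
    have hrtop : Tendsto r atTop atTop :=
      tendsto_atTop_mono hrk (tendsto_atTop_add_const_right _ _ tendsto_natCast_atTop_atTop)
    -- `U k` consists of the elements whose mean over the disk of radius `r k` about `0` is below `c`.
    let U : ℕ → Set M := fun k => {f | ∫⁻ z in ball 0 (r k), F f z <
      ENNReal.ofReal c * ENNReal.ofReal (Real.pi * r k ^ 2)}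
    have hUo : ∀ k, IsOpen (U k) := fun k => isOpen_lt (hcont _) continuous_const
    have hNU : N ⊆ ⋃ k, U k := by
      intro f hf
      have hfc : ρ f < c := (le_iSup₂ (f := fun f (_ : f ∈ N) => ρ f) f hf).trans_lt hc
      obtain ⟨k, hk⟩ := (hrtop.eventually ((hlim f).eventually_lt_const hfc)).exists
      refine Set.mem_iUnion.2 ⟨k, ?_⟩
      have hp : 0 < Real.pi * r k ^ 2 := by have := hr0 k; positivity
      rw [ENNReal.div_lt_iff (Or.inl (by simpa using hp)) (Or.inl ENNReal.ofReal_ne_top)] at hk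
      rw [Set.mem_ofPred_eq]
      rw [ENNReal.ofReal_coe_nnreal]
      exact (le_iSup (fun a => ∫⁻ z in ball a (r k), F f z) 0).trans_lt hk
    obtain ⟨t, ht⟩ := hN.elim_finite_subcover U hUo hNU
    -- The slack `1 / R` in the choice of a nearly maximal `f` disappears in the limit `R → ∞`.
    have key : ∀ᶠ R : ℝ in atTop, (l - c : ℝ) ≤
        ∑ k ∈ t, ((l + δ k) * (1 + r k / R) ^ 2 - (l - 1 / R)) := by
      have hl0 : (0 : ℝ) < l := c.2.trans_lt hcl
      filter_upwards [eventually_gt_atTop 0,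
        (tendsto_const_nhds (x := (1 : ℝ))).div_atTop tendsto_id |>.eventually_lt_const hl0]
        with R hR hRl
      simp only [id] at hRl
      have hp : 0 < Real.pi * R ^ 2 := by positivity
      have h1 : ENNReal.ofReal (l - 1 / R) * ENNReal.ofReal (Real.pi * R ^ 2) <
          ⨆ f ∈ N, ∫⁻ z in ball 0 R, F f z := by
        rw [← ENNReal.lt_div_iff_mul_lt (Or.inl (by simpa using hp))
          (Or.inl ENNReal.ofReal_ne_top)]
        have h2 : ENNReal.ofReal (l - 1 / R) < l := by
          rw [← ENNReal.ofReal_coe_nnreal (p := l)]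
          exact (ENNReal.ofReal_lt_ofReal_iff hl0).2 (by have : 0 < 1 / R := by positivity
                                                         linarith)
        refine h2.trans_le ?_
        rw [hl]
        exact iInf_le (fun r : Set.Ioi (0 : ℝ) => (⨆ f ∈ N, ∫⁻ z in ball 0 (r : ℝ), F f z) /
          ENNReal.ofReal (Real.pi * (r : ℝ) ^ 2)) ⟨R, hR⟩
      simp only [lt_iSup_iff] at h1
      obtain ⟨f, hf, hfR⟩ := h1
      let A : ℕ → Set ℂ := fun k => {b ∈ ball (0 : ℂ) R | ∫⁻ z in ball b (r k), F f z <
        ENNReal.ofReal c * ENNReal.ofReal (Real.pi * r k ^ 2)}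
      have hA : ∀ k, ((l + δ k) - c) * volume.real (A k) ≤
          (l + δ k) * (Real.pi * (R + r k) ^ 2) - (l - 1 / R) * (Real.pi * R ^ 2) := fun k =>
        volume_low_average_le (hmeas f) (hr0 k) hR.le c.2
          (by have := hδ k; linarith) (by linarith) (hrM k f hf) hfR.le
      -- Every centre is low at one of the finitely many radii: translate the centre to the origin.
      have hcov : ball (0 : ℂ) R ⊆ ⋃ k ∈ t, A k := by
        intro b hb
        obtain ⟨k, hk, hkU⟩ := Set.mem_iUnion₂.1 (ht (hT b f hf))
        refine Set.mem_iUnion₂.2 ⟨k, hk, hb, ?_⟩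
        rw [hshift]
        exact hkU
      have hvol : Real.pi * R ^ 2 ≤ ∑ k ∈ t, volume.real (A k) := by
        have h2 : volume.real (ball (0 : ℂ) R) = Real.pi * R ^ 2 := by
          rw [measureReal_def, volume_ball_eq 0 hR.le, ENNReal.toReal_ofReal hp.le]
        rw [← h2]
        refine (measureReal_mono hcov ?_).trans (measureReal_biUnion_finset_le t A)
        refine ((measure_mono (Set.iUnion₂_subset fun k _ b hb => hb.1)).trans_lt
          (measure_ball_lt_top (x := (0 : ℂ)) (r := R))).ne
      rw [← mul_le_mul_iff_left₀ hp, Finset.sum_mul]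
      calc (l - c : ℝ) * (Real.pi * R ^ 2) ≤ (l - c) * ∑ k ∈ t, volume.real (A k) :=
            mul_le_mul_of_nonneg_left hvol (sub_pos.2 hcl).le
        _ = ∑ k ∈ t, (l - c) * volume.real (A k) := Finset.mul_sum ..
        _ ≤ _ := Finset.sum_le_sum fun k _ => by
            have h3 : (l - c : ℝ) * volume.real (A k) ≤ ((l + δ k) - c) * volume.real (A k) :=
              mul_le_mul_of_nonneg_right (by have := hδ k; linarith) measureReal_nonneg
            refine h3.trans ((hA k).trans_eq ?_)
            field_simp
    have hlimR : Tendsto (fun R : ℝ => ∑ k ∈ t, ((l + δ k) * (1 + r k / R) ^ 2 - (l - 1 / R)))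
        atTop (𝓝 (∑ k ∈ t, ((l + δ k) * (1 + 0) ^ 2 - (l - 0)))) := by
      refine tendsto_finsetSum _ fun k _ => ?_
      have h0 : ∀ x : ℝ, Tendsto (fun R : ℝ => x / R) atTop (𝓝 0) := fun x =>
        (tendsto_const_nhds (x := x)).div_atTop tendsto_id
      exact ((((h0 (r k)).const_add 1).pow 2).const_mul _).sub ((h0 1).const_sub _)
    have h1 := ge_of_tendsto hlimR key
    have h2 := hδsum t (Set.subset_univ _)
    simp only [add_zero, one_pow, mul_one, sub_zero, add_sub_cancel_left] at h1
    linarith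
  have heq := le_antisymm hle hge
  refine ⟨hlim, heq ▸ hL1, ?_⟩
  rw [heq]
  exact hlimN

end Dynamics

/-! ### Limits of holomorphic maps into a complex manifold -/

section HolomorphicLimits

/-- Joint continuity at the points of `{a} × s` gives locally uniform convergence on `s` as the
parameter tends to `a`. -/
theorem tendstoLocallyUniformlyOn_of_continuousAt {A B Y : Type*} [TopologicalSpace A]
    [TopologicalSpace B] [UniformSpace Y] {F : A → B → Y} {a : A} {s : Set B}
    (h : ∀ b ∈ s, ContinuousAt (fun p : A × B => F p.1 p.2) (a, b)) :
    TendstoLocallyUniformlyOn F (F a) (𝓝 a) s := by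
  intro u hu b hb
  obtain ⟨v, hv, hvs, hvu⟩ := comp_symm_mem_uniformity_sets hu
  have h1 : ∀ᶠ p : A × B in 𝓝 (a, b), (F a b, F p.1 p.2) ∈ v :=
    (h b hb).eventually (mem_nhds_left (F a b) hv)
  rw [nhds_prod_eq, eventually_prod_iff] at h1
  obtain ⟨P, hP, Q, hQ, hPQ⟩ := h1
  refine ⟨{y | Q y}, mem_nhdsWithin_of_mem_nhds hQ, hP.mono fun f hf y hy => ?_⟩
  exact hvu ⟨F a b, hvs.symm _ _ (hPQ hP.self_of_nhds hy), hPQ hf hy⟩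

theorem tendstoLocallyUniformlyOn_filter_mono {A B Y : Type*} [UniformSpace Y]
    [TopologicalSpace B] {F : A → B → Y} {f : B → Y} {s : Set B} {p q : Filter A}
    (h : TendstoLocallyUniformlyOn F f p s) (hqp : q ≤ p) : TendstoLocallyUniformlyOn F f q s :=
  fun u hu b hb => let ⟨t, ht, hp⟩ := h u hu b hb; ⟨t, ht, hp.filter_mono hqp⟩

section Chart

variable {E : Type*} [NormedAddCommGroup E]
  {X : Type*} [TopologicalSpace X] [ChartedSpace E X]

/-- Near a given point of `ℂ`, compact-open convergence of maps into `X` is locally uniform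
convergence of their expressions in a single chart. -/
theorem exists_chart_tendstoLocallyUniformlyOn (f₀ : C(ℂ, X)) (z : ℂ) :
    ∃ U : Set ℂ, IsOpen U ∧ z ∈ U ∧
      Set.MapsTo f₀ U (chartAt E (f₀ z)).source ∧
      (∀ᶠ f : C(ℂ, X) in 𝓝 f₀, Set.MapsTo f U (chartAt E (f₀ z)).source) ∧
      TendstoLocallyUniformlyOn (fun (f : C(ℂ, X)) w => chartAt E (f₀ z) (f w))
        (fun w => chartAt E (f₀ z) (f₀ w)) (𝓝 f₀) U := by
  have hz : f₀ ⁻¹' (chartAt E (f₀ z)).source ∈ 𝓝 z :=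
    f₀.continuous.continuousAt.preimage_mem_nhds (chart_source_mem_nhds E _)
  obtain ⟨K, hKn, hKs, hK⟩ := local_compact_nhds hz
  have hev : ∀ᶠ f : C(ℂ, X) in 𝓝 f₀, Set.MapsTo f K (chartAt E (f₀ z)).source :=
    ContinuousMap.eventually_mapsTo hK (chartAt E (f₀ z)).open_source hKs
  refine ⟨interior K, isOpen_interior, mem_interior_iff_mem_nhds.2 hKn,
    fun w hw => hKs (interior_subset hw), hev.mono fun f hf => hf.mono_left interior_subset, ?_⟩
  refine tendstoLocallyUniformlyOn_of_continuousAt fun w hw => ?_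
  have hev : ContinuousAt (fun p : C(ℂ, X) × ℂ => p.1 p.2) (f₀, w) :=
    continuous_eval.continuousAt
  exact ContinuousAt.comp (f := fun p : C(ℂ, X) × ℂ => p.1 p.2)
    ((chartAt E (f₀ z)).continuousAt (hKs (interior_subset hw))) hev

end Chart

variable {E : Type*} [NormedAddCommGroup E] [NormedSpace ℂ E]
  {X : Type*} [TopologicalSpace X] [ChartedSpace E X]

theorem hasMFDerivAt_real {f : ℂ → X} {z : ℂ}
    (hf : MDifferentiableAt 𝓘(ℂ, ℂ) 𝓘(ℂ, E) f z) :
    HasMFDerivAt 𝓘(ℝ, ℂ) 𝓘(ℝ, E) f z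
      ((show ℂ →L[ℂ] E from mfderiv 𝓘(ℂ, ℂ) 𝓘(ℂ, E) f z).restrictScalars ℝ) :=
  ⟨hf.hasMFDerivAt.1, hf.hasMFDerivAt.2.restrictScalars ℝ⟩

/-- The real derivative of a holomorphic map is complex linear, hence determined by its value at
`1`. -/
theorem mfderiv_real_apply {f : ℂ → X} {z : ℂ}
    (hf : MDifferentiableAt 𝓘(ℂ, ℂ) 𝓘(ℂ, E) f z) (v : ℂ) :
    (show E from mfderiv 𝓘(ℝ, ℂ) 𝓘(ℝ, E) f z v) =
      v • (show E from mfderiv 𝓘(ℝ, ℂ) 𝓘(ℝ, E) f z (1 : ℂ)) := by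
  rw [(hasMFDerivAt_real hf).mfderiv]
  change (show ℂ →L[ℂ] E from mfderiv 𝓘(ℂ, ℂ) 𝓘(ℂ, E) f z) v =
    v • (show ℂ →L[ℂ] E from mfderiv 𝓘(ℂ, ℂ) 𝓘(ℂ, E) f z) 1
  rw [← map_smul, smul_eq_mul, mul_one]

variable [IsManifold 𝓘(ℂ, E) ω X]

theorem differentiableAt_chart {f : ℂ → X} {z : ℂ} {x : X}
    (hf : MDifferentiableAt 𝓘(ℂ, ℂ) 𝓘(ℂ, E) f z) (hz : f z ∈ (chartAt E x).source) :
    DifferentiableAt ℂ (fun w => chartAt E x (f w)) z := by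
  have := ((mdifferentiableAt_iff_target_of_mem_source hz).1 hf).2
  simpa [mdifferentiableAt_iff_differentiableAt] using! this

theorem mdifferentiableAt_of_chart {f : ℂ → X} {z : ℂ} {x : X} (hc : ContinuousAt f z)
    (hz : f z ∈ (chartAt E x).source) (h : DifferentiableAt ℂ (fun w => chartAt E x (f w)) z) :
    MDifferentiableAt 𝓘(ℂ, ℂ) 𝓘(ℂ, E) f z := by
  refine (mdifferentiableAt_iff_target_of_mem_source hz).2 ⟨hc, ?_⟩
  exact mdifferentiableAt_iff_differentiableAt.2 h

/-- Weierstrass' theorem for maps into a complex manifold. -/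
theorem isClosed_holomorphic [CompleteSpace E] :
    IsClosed {f : C(ℂ, X) | MDifferentiable 𝓘(ℂ, ℂ) 𝓘(ℂ, E) f} := by
  refine isClosed_of_closure_subset fun f₀ hf₀ z => ?_
  obtain ⟨U, hUo, hzU, hf₀U, hev, hlim⟩ := exists_chart_tendstoLocallyUniformlyOn (E := E) f₀ z
  have : (𝓝[{f : C(ℂ, X) | MDifferentiable 𝓘(ℂ, ℂ) 𝓘(ℂ, E) f}] f₀).NeBot :=
    mem_closure_iff_nhdsWithin_neBot.1 hf₀
  have hd : ∀ᶠ f : C(ℂ, X) in 𝓝[{f : C(ℂ, X) | MDifferentiable 𝓘(ℂ, ℂ) 𝓘(ℂ, E) f}] f₀,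
      DifferentiableOn ℂ (fun w => chartAt E (f₀ z) (f w)) U := by
    filter_upwards [hev.filter_mono nhdsWithin_le_nhds, self_mem_nhdsWithin] with f hf hfh w hw
    exact (differentiableAt_chart (hfh w) (hf hw)).differentiableWithinAt
  have h := TendstoLocallyUniformlyOn.differentiableOn
    (tendstoLocallyUniformlyOn_filter_mono hlim nhdsWithin_le_nhds) hd hUo
  exact mdifferentiableAt_of_chart f₀.continuous.continuousAt (hf₀U hzU)
    (h.differentiableAt (hUo.mem_nhds hzU))

/-- The derivative in a chart is continuous along holomorphic maps, in the compact-open topology. -/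
theorem tendsto_deriv_chart [CompleteSpace E] (f₀ : C(ℂ, X)) (z : ℂ) :
    Tendsto (fun f : C(ℂ, X) => deriv (fun w => chartAt E (f₀ z) (f w)) z)
      (𝓝[{f : C(ℂ, X) | MDifferentiable 𝓘(ℂ, ℂ) 𝓘(ℂ, E) f}] f₀)
      (𝓝 (deriv (fun w => chartAt E (f₀ z) (f₀ w)) z)) := by
  obtain ⟨U, hUo, hzU, hf₀U, hev, hlim⟩ := exists_chart_tendstoLocallyUniformlyOn (E := E) f₀ z
  have hd : ∀ᶠ f : C(ℂ, X) in 𝓝[{f : C(ℂ, X) | MDifferentiable 𝓘(ℂ, ℂ) 𝓘(ℂ, E) f}] f₀,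
      DifferentiableOn ℂ (fun w => chartAt E (f₀ z) (f w)) U := by
    filter_upwards [hev.filter_mono nhdsWithin_le_nhds, self_mem_nhdsWithin] with f hf hfh w hw
    exact (differentiableAt_chart (hfh w) (hf hw)).differentiableWithinAt
  exact ((tendstoLocallyUniformlyOn_filter_mono hlim nhdsWithin_le_nhds).deriv hd hUo).tendsto_at hzU

theorem contMDiff_real_of_holomorphic [CompleteSpace E] {f : ℂ → X}
    (hf : MDifferentiable 𝓘(ℂ, ℂ) 𝓘(ℂ, E) f) : ContMDiff 𝓘(ℝ, ℂ) 𝓘(ℝ, E) 1 f := by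
  intro z
  have hz : f z ∈ (chartAt E (f z)).source := mem_chart_source E (f z)
  refine (contMDiffAt_iff_target_of_mem_source hz).2 ⟨(hf z).continuousAt, ?_⟩
  have hU : ∀ᶠ w in 𝓝 z, f w ∈ (chartAt E (f z)).source :=
    (hf z).continuousAt.eventually (chart_source_mem_nhds E _)
  have hd : ∀ᶠ w in 𝓝 z, DifferentiableAt ℂ (fun w => chartAt E (f z) (f w)) w :=
    hU.mono fun w hw => differentiableAt_chart (hf w) hw
  have ha : AnalyticAt ℂ (fun w => chartAt E (f z) (f w)) z :=
    Complex.analyticAt_iff_eventually_differentiableAt.2 hd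
  have hc : ContDiffAt ℝ 1 (fun w => chartAt E (f z) (f w)) z :=
    (ha.contDiffAt (n := 1)).restrict_scalars ℝ
  exact hc.contMDiffAt

/-- In the coordinates of the tangent bundle at `x`, the velocity of `f` is the derivative of `f`
read in the chart at `x`. -/
theorem continuousLinearMapAt_mfderiv_one {f : ℂ → X} {z : ℂ} {x : X}
    (hf : MDifferentiableAt 𝓘(ℂ, ℂ) 𝓘(ℂ, E) f z) (hz : f z ∈ (chartAt E x).source) :
    (trivializationAt E (TangentSpace 𝓘(ℝ, E) : X → Type _) x).continuousLinearMapAt ℝ (f z)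
      (mfderiv 𝓘(ℝ, ℂ) 𝓘(ℝ, E) f z (1 : ℂ)) = deriv (fun w => chartAt E x (f w)) z := by
  rw [TangentBundle.continuousLinearMapAt_trivializationAt hz]
  have h1 : MDifferentiableAt 𝓘(ℝ, E) 𝓘(ℝ, E) (extChartAt 𝓘(ℝ, E) x) (f z) :=
    mdifferentiableAt_extChartAt hz
  have h2 := (HasMFDerivAt.comp z h1.hasMFDerivAt (mdifferentiableAt_real hf).hasMFDerivAt)
  have h3 := h2.mfderiv
  have h4 := ((differentiableAt_chart hf hz).hasDerivAt.hasFDerivAt.restrictScalars ℝ).hasMFDerivAt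
  have h5 : ∀ L L' : ℂ →L[ℝ] E, L = L' → L 1 = L' 1 := fun _ _ h => h ▸ rfl
  exact (h5 _ _ (h3.symm.trans h4.mfderiv)).trans (by simp)

end HolomorphicLimits

/-! ### The spherical derivative and the Hermitian metric -/

section Hermitian

variable {E : Type*} [NormedAddCommGroup E] [NormedSpace ℂ E]
  {X : Type*} [TopologicalSpace X] [ChartedSpace E X]

theorem J_J {x : X} (v : TangentSpace 𝓘(ℝ, E) x) : J (J v) = -v := by
  change (Complex.I • (Complex.I • (show E from v)) : E) = -(show E from v)
  rw [smul_smul, Complex.I_mul_I, neg_one_smul]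

variable [IsManifold 𝓘(ℂ, E) ω X] (g : HermitianMetric E X)

theorem inner_J_self {x : X} (v : TangentSpace 𝓘(ℝ, E) x) : g.inner x (J v) v = 0 := by
  have h1 := g.inner_J x (J v) v
  rw [J_J, map_neg, neg_apply, g.symm x v (J v)] at h1
  linarith

/-- Complex scalars scale the squared norm of a Hermitian metric by the square of their modulus. -/
theorem inner_smul_self {x : X} (c : ℂ) (u v : TangentSpace 𝓘(ℝ, E) x)
    (h : (show E from u) = c • (show E from v)) :
    g.inner x u u = ‖c‖ ^ 2 * g.inner x v v := by
  have hu : u = c.re • v + c.im • J v := by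
    change (show E from u) = c.re • (show E from v) + c.im • (Complex.I • (show E from v))
    rw [h]
    conv_lhs => rw [← Complex.re_add_im c, add_smul, mul_smul]
    rfl
  have h0 := inner_J_self g v
  have h0' := h0
  rw [g.symm] at h0'
  rw [hu]
  simp only [map_add, map_smul, add_apply, smul_apply, smul_eq_mul, h0, h0', g.inner_J x v v]
  rw [Complex.sq_norm, Complex.normSq_apply]
  ring

/-- For holomorphic `f`, the density of `f^* ω` is the squared norm of the velocity `df(∂/∂x)`,
because `df(∂/∂y) = J df(∂/∂x)`. -/
theorem pullbackKahler_eq {f : ℂ → X} {z : ℂ} (hf : MDifferentiableAt 𝓘(ℂ, ℂ) 𝓘(ℂ, E) f z) :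
    pullbackKahler g f z = g.inner (f z) (mfderiv 𝓘(ℝ, ℂ) 𝓘(ℝ, E) f z (1 : ℂ))
      (mfderiv 𝓘(ℝ, ℂ) 𝓘(ℝ, E) f z (1 : ℂ)) := by
  have h : mfderiv 𝓘(ℝ, ℂ) 𝓘(ℝ, E) f z Complex.I = J (mfderiv 𝓘(ℝ, ℂ) 𝓘(ℝ, E) f z (1 : ℂ)) :=
    mfderiv_real_apply hf Complex.I
  rw [pullbackKahler, kahlerForm, h, g.inner_J]

theorem inner_mfderiv_self_le {f : ℂ → X} {z : ℂ}
    (hf : MDifferentiableAt 𝓘(ℂ, ℂ) 𝓘(ℂ, E) f z) (h1 : sphericalDeriv g f z ≤ 1) (v : ℂ) :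
    g.inner (f z) (mfderiv 𝓘(ℝ, ℂ) 𝓘(ℝ, E) f z v) (mfderiv 𝓘(ℝ, ℂ) 𝓘(ℝ, E) f z v) ≤
      ‖v‖ ^ 2 := by
  rw [inner_smul_self g v _ _ (mfderiv_real_apply hf v), ← pullbackKahler_eq g hf]
  have : pullbackKahler g f z ≤ 1 := by
    simpa using (Real.sqrt_le_iff.1 h1).2
  nlinarith [sq_nonneg ‖v‖]

/-- The Riemannian metric underlying a Hermitian metric, as an inner product structure on the
tangent spaces. It is used as a local instance only, since it depends on `g`. -/
abbrev riemannianBundle : RiemannianBundle (TangentSpace 𝓘(ℝ, E) : X → Type _) :=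
  ⟨g.toContMDiffRiemannianMetric.toRiemannianMetric⟩

theorem isContinuousRiemannianBundle :
    letI := riemannianBundle g
    IsContinuousRiemannianBundle E (TangentSpace 𝓘(ℝ, E) : X → Type _) :=
  letI := riemannianBundle g
  ⟨g.inner, g.contMDiff.continuous, fun _ _ _ => rfl⟩

theorem continuousOn_pullbackKahler [CompleteSpace E] (z : ℂ) :
    ContinuousOn (fun f : C(ℂ, X) => pullbackKahler g f z)
      {f : C(ℂ, X) | MDifferentiable 𝓘(ℂ, ℂ) 𝓘(ℂ, E) f} := by
  let := riemannianBundle g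
  have := isContinuousRiemannianBundle g
  have h : ContinuousOn (fun f : C(ℂ, X) => inner ℝ
      (mfderiv 𝓘(ℝ, ℂ) 𝓘(ℝ, E) f z (1 : ℂ) : TangentSpace 𝓘(ℝ, E) (f z))
      (mfderiv 𝓘(ℝ, ℂ) 𝓘(ℝ, E) f z (1 : ℂ) : TangentSpace 𝓘(ℝ, E) (f z)))
      {f : C(ℂ, X) | MDifferentiable 𝓘(ℂ, ℂ) 𝓘(ℂ, E) f} := by
    have hc : ContinuousOn (fun f : C(ℂ, X) => (⟨f z, mfderiv 𝓘(ℝ, ℂ) 𝓘(ℝ, E) f z (1 : ℂ)⟩ :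
        TotalSpace E (TangentSpace 𝓘(ℝ, E) : X → Type _)))
        {f : C(ℂ, X) | MDifferentiable 𝓘(ℂ, ℂ) 𝓘(ℂ, E) f} := by
      intro f₀ hf₀
      have hev : ContinuousAt (fun f : C(ℂ, X) => f z) f₀ :=
        (continuous_eval_const z).continuousAt
      rw [FiberBundle.continuousWithinAt_totalSpace]
      refine ⟨hev.continuousWithinAt, ?_⟩
      have hcoord : ∀ f : C(ℂ, X), MDifferentiable 𝓘(ℂ, ℂ) 𝓘(ℂ, E) f →
          f z ∈ (chartAt E (f₀ z)).source →
          (trivializationAt E (TangentSpace 𝓘(ℝ, E) : X → Type _) (f₀ z)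
            ⟨f z, mfderiv 𝓘(ℝ, ℂ) 𝓘(ℝ, E) f z (1 : ℂ)⟩).2 =
            deriv (fun w => chartAt E (f₀ z) (f w)) z := by
        intro f hf hz
        rw [← continuousLinearMapAt_mfderiv_one (hf z) hz,
          Trivialization.continuousLinearMapAt_apply, Trivialization.linearMapAt_apply,
          if_pos (by simpa using hz)]
      refine Tendsto.congr' ?_ ((hcoord f₀ hf₀ (mem_chart_source E _)).symm ▸
        tendsto_deriv_chart f₀ z)
      filter_upwards [self_mem_nhdsWithin, (hev.eventually
        (chart_source_mem_nhds E (f₀ z))).filter_mono nhdsWithin_le_nhds] with f hf hfz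
      exact (hcoord f hf hfz).symm
    exact hc.inner_bundle hc
  exact h.congr fun f hf => pullbackKahler_eq g (hf z)

/-- A Brody curve does not increase distances, from the Euclidean metric of `ℂ` to the Riemannian
distance of `X`: the image of a segment is at most as long as the segment. -/
theorem riemannianEDist_le [CompleteSpace E] {f : ℂ → X}
    (hf : MDifferentiable 𝓘(ℂ, ℂ) 𝓘(ℂ, E) f)
    (h1 : ∀ z, sphericalDeriv g f z ≤ 1) (z w : ℂ) :
    letI := riemannianBundle g
    Manifold.riemannianEDist 𝓘(ℝ, E) (f z) (f w) ≤ edist z w := by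
  let := riemannianBundle g
  have hη : ContDiff ℝ 1 (fun t : ℝ => z + t • (w - z)) := by fun_prop
  have hγ : ContMDiff 𝓘(ℝ, ℝ) 𝓘(ℝ, E) 1 (fun t : ℝ => f (z + t • (w - z))) :=
    (contMDiff_real_of_holomorphic hf).comp hη.contMDiff
  refine (Manifold.riemannianEDist_le_pathELength (a := 0) (b := 1) hγ.contMDiffOn
    (by simp) (by simp) zero_le_one).trans ?_
  rw [Manifold.pathELength_eq_lintegral_mfderiv_Icc]
  have hle : ∀ t : ℝ, ‖mfderiv 𝓘(ℝ, ℝ) 𝓘(ℝ, E) (fun t : ℝ => f (z + t • (w - z))) t (1 : ℝ)‖ₑ ≤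
      edist z w := by
    intro t
    have hd1 : HasMFDerivAt 𝓘(ℝ, ℝ) 𝓘(ℝ, ℂ) (fun t : ℝ => z + t • (w - z)) t
        (ContinuousLinearMap.toSpanSingleton ℝ (w - z)) :=
      (((hasDerivAt_id t).smul_const (w - z)).const_add z |>.congr_deriv
        (by simp)).hasFDerivAt.hasMFDerivAt
    have hd := (HasMFDerivAt.comp t
      (mdifferentiableAt_real (hf (z + t • (w - z)))).hasMFDerivAt hd1).mfderiv
    have hd' : mfderiv 𝓘(ℝ, ℝ) 𝓘(ℝ, E) (fun t : ℝ => f (z + t • (w - z))) t (1 : ℝ) =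
        mfderiv 𝓘(ℝ, ℂ) 𝓘(ℝ, E) f (z + t • (w - z)) (w - z) := by
      have h5 : ∀ L L' : ℝ →L[ℝ] E, L = L' → L 1 = L' 1 := fun _ _ h => h ▸ rfl
      refine (h5 _ _ hd).trans ?_
      change mfderiv 𝓘(ℝ, ℂ) 𝓘(ℝ, E) f (z + t • (w - z))
        (ContinuousLinearMap.toSpanSingleton ℝ (w - z) (1 : ℝ)) = _
      simp
    rw [hd', edist_comm, edist_eq_enorm_sub, ← ofReal_norm, ← ofReal_norm]
    refine ENNReal.ofReal_le_ofReal ?_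
    rw [norm_eq_sqrt_real_inner]
    refine Real.sqrt_le_iff.2 ⟨norm_nonneg _, ?_⟩
    exact inner_mfderiv_self_le g (hf _) (h1 _) (w - z)
  refine (lintegral_mono hle).trans ?_
  simp

end Hermitian

/-! ### Compactness of the space of Brody curves -/

section Compactness

/-- Arzelà–Ascoli for `1`-Lipschitz maps from the plane into a compact metric space. Distances are
extended, because the target may be disconnected. -/
theorem isCompact_setOf_lipschitz (Y : Type*) [EMetricSpace Y] [CompactSpace Y] :
    IsCompact {f : C(ℂ, Y) | ∀ z w, edist (f z) (f w) ≤ edist z w} := by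
  refine ArzelaAscoli.isCompact_of_equicontinuous _ ?_ ?_
  · have himg : ContinuousMap.toFun '' {f : C(ℂ, Y) | ∀ z w, edist (f z) (f w) ≤ edist z w} =
        {f : ℂ → Y | ∀ z w, edist (f z) (f w) ≤ edist z w} := by
      ext f
      refine ⟨fun ⟨h, hh, hf⟩ => hf ▸ hh, fun hf => ⟨⟨f, ?_⟩, hf, rfl⟩⟩
      exact LipschitzWith.continuous (K := 1) fun z w => by simpa using hf z w
    rw [himg]
    refine IsClosed.isCompact ?_
    simp only [Set.ofPred_forall]
    exact isClosed_iInter fun z => isClosed_iInter fun w =>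
      isClosed_le (by fun_prop) continuous_const
  · refine LipschitzWith.uniformEquicontinuous _ 1 (fun f => ?_) |>.equicontinuous
    exact fun z w => by simpa using! f.2 z w

variable {E : Type*} [NormedAddCommGroup E] [NormedSpace ℂ E]
  {X : Type*} [TopologicalSpace X] [ChartedSpace E X] [IsManifold 𝓘(ℂ, E) ω X]
  (g : HermitianMetric E X)

/-- `|df|²` and the coefficient of `f^* ω` agree as densities with values in `[0, ∞]`; this holds
without positivity, since `√` and `ENNReal.ofReal` both vanish on negative reals. -/
theorem sphericalDeriv_sq (f : BrodyCurve g) (z : ℂ) :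
    ENNReal.ofReal (sphericalDeriv g f.1 z ^ 2) = ENNReal.ofReal (pullbackKahler g f.1 z) := by
  rcases le_total 0 (pullbackKahler g f.1 z) with h | h
  · rw [sphericalDeriv, Real.sq_sqrt h]
  · rw [sphericalDeriv, Real.sqrt_eq_zero_of_nonpos h, ENNReal.ofReal_of_nonpos h]
    simp

theorem continuous_pullbackKahler_apply [CompleteSpace E] (z : ℂ) :
    Continuous fun f : BrodyCurve g => pullbackKahler g f.1 z :=
  (continuousOn_pullbackKahler g z).comp_continuous continuous_subtype_val fun f => f.2.1

/-- Continuity in the point `z` follows from continuity in the curve, as `|df|(z)` is the value at `0`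
for the curve translated by `z`. -/
theorem continuous_pullbackKahler [CompleteSpace E] (f : BrodyCurve g) :
    Continuous (pullbackKahler g f.1) := by
  have h1 : Continuous fun a : ℂ => (translate g a f).1 := by
    let F : C(ℂ × ℂ, X) := ⟨fun p => f.1 (p.2 + p.1), by fun_prop⟩
    exact F.curry.continuous
  have h2 : Continuous fun a : ℂ => translate g a f := h1.subtype_mk _
  refine ((continuous_pullbackKahler_apply g 0).comp h2).congr fun a => ?_
  have := pullbackKahler_translate g f.2.1 a 0
  rw [zero_add] at this
  exact this

theorem isClosed_brody [CompleteSpace E] :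
    IsClosed {f : C(ℂ, X) | MDifferentiable 𝓘(ℂ, ℂ) 𝓘(ℂ, E) f ∧ ∀ z, sphericalDeriv g f z ≤ 1} := by
  have h : {f : C(ℂ, X) | MDifferentiable 𝓘(ℂ, ℂ) 𝓘(ℂ, E) f ∧ ∀ z, sphericalDeriv g f z ≤ 1} =
      ⋂ z : ℂ, {f : C(ℂ, X) | MDifferentiable 𝓘(ℂ, ℂ) 𝓘(ℂ, E) f} ∩
        (fun f : C(ℂ, X) => pullbackKahler g f z) ⁻¹' Set.Iic 1 := by
    ext f
    simp [sphericalDeriv, Real.sqrt_le_iff, forall_and]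
  rw [h]
  exact isClosed_iInter fun z =>
    (continuousOn_pullbackKahler g z).preimage_isClosed_of_isClosed isClosed_holomorphic isClosed_Iic

theorem compactSpace_brodyCurve [CompleteSpace E] [T2Space X] [CompactSpace X] :
    CompactSpace (BrodyCurve g) := by
  let := riemannianBundle g
  have := isContinuousRiemannianBundle g
  let : EMetricSpace X := EMetricSpace.ofRiemannianMetric 𝓘(ℝ, E) X
  exact isCompact_iff_compactSpace.1 <|
    (isCompact_setOf_lipschitz X).of_isClosed_subset (isClosed_brody g)
    fun f hf z w => riemannianEDist_le g hf.1 hf.2 z w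

/-- The manifold is compact and metrizable by the Riemannian distance. Second countability makes
the compact-open topology first countable, as dominated convergence requires. -/
theorem secondCountableTopology_of_hermitianMetric (g : HermitianMetric E X) [T2Space X]
    [CompactSpace X] : SecondCountableTopology X := by
  let := riemannianBundle g
  have := isContinuousRiemannianBundle g
  let : EMetricSpace X := EMetricSpace.ofRiemannianMetric 𝓘(ℝ, E) X
  infer_instance

theorem energyDensity_le_one (f : BrodyCurve g) (z : ℂ) :
    ENNReal.ofReal (sphericalDeriv g f.1 z ^ 2) ≤ 1 :=
  ENNReal.ofReal_le_one.2 (pow_le_one₀ (Real.sqrt_nonneg _) (f.2.2 z))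

theorem measurable_energyDensity [CompleteSpace E] (f : BrodyCurve g) :
    Measurable fun z => ENNReal.ofReal (sphericalDeriv g f.1 z ^ 2) := by
  simp_rw [sphericalDeriv_sq]
  exact (ENNReal.continuous_ofReal.comp (continuous_pullbackKahler g f)).measurable

theorem continuous_energy [CompleteSpace E] [T2Space X] [CompactSpace X] (a : ℂ) (r : ℝ) :
    Continuous fun f : BrodyCurve g => energy g f a r := by
  have := secondCountableTopology_of_hermitianMetric g
  have : FirstCountableTopology (BrodyCurve g) :=
    Topology.IsInducing.subtypeVal.firstCountableTopology
  refine continuous_iff_continuousAt.2 fun f₀ => ?_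
  refine tendsto_lintegral_filter_of_dominated_convergence 1
    (Eventually.of_forall fun f => measurable_energyDensity g f)
    (Eventually.of_forall fun f => Eventually.of_forall fun z => energyDensity_le_one g f z) ?_
    (Eventually.of_forall fun z => ?_)
  · simpa using (measure_ball_lt_top (μ := volume) (x := a) (r := r)).ne
  · simp_rw [sphericalDeriv_sq]
    exact (ENNReal.continuous_ofReal.comp (continuous_pullbackKahler_apply g z)).continuousAt

end Compactness

end BrodyDensity

end

open BrodyDensity in
theorem theorem2 {E : Type*} [NormedAddCommGroup E] [NormedSpace ℂ E] [FiniteDimensional ℂ E]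
    {X : Type*} [TopologicalSpace X] [ChartedSpace E X] [IsManifold 𝓘(ℂ, E) ω X]
    [T2Space X] [CompactSpace X]
    (g : HermitianMetric E X)
    (N : Set (BrodyCurve g)) (hclosed : IsClosed N)
    (hinv : ∀ (a : ℂ), ∀ f ∈ N, translate g a f ∈ N) :
    (∀ f ∈ N, Filter.Tendsto (meanEnergy g f) Filter.atTop (𝓝 (rho g f))) ∧
    rhoSet g N ≠ ⊤ ∧
    Filter.Tendsto
      (fun R : ℝ => (⨆ f ∈ N, energy g f 0 R) / ENNReal.ofReal (Real.pi * R ^ 2))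
      Filter.atTop (𝓝 (rhoSet g N)) := by
  have : CompleteSpace E := FiniteDimensional.complete ℂ E
  have : CompactSpace (BrodyCurve g) := compactSpace_brodyCurve g
  obtain ⟨h1, h2, h3⟩ := iSup_limit_density_eq hclosed.isCompact
    (F := fun f z => ENNReal.ofReal (sphericalDeriv g f.1 z ^ 2)) (T := translate g)
    (measurable_energyDensity g) (energyDensity_le_one g) hinv
    (fun a f z => congrArg (fun t => ENNReal.ofReal (√t ^ 2))
      (pullbackKahler_translate g f.2.1 a z))
    (continuous_energy g 0)
  exact ⟨fun f _ => h1 f, (h2.trans_lt ENNReal.one_lt_top).ne, h3⟩
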